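/- Let $N\ge 1$ and let $H_x$, $x\in[0,1]$, be a path of self-adjoint $N\times N$ complex matrices that is smooth ($C^2$ suffices), with eigenvalues in nondecreasing order $e_0(x)\le e_1(x)\le\dots\le e_{N-1}(x)$ (counted with multiplicity), and let $\gamma:[0,1]\to[0,\infty)$ be smooth ($C^1$ suffices). Assume the gap condition $e_a(x)\neq e_b(x)$ for all $a\ne b$ and all $x\in[0,1]$, and let $P_a(x)$ be the spectral projection of $H_x$ belonging to $e_a(x)$. Consider the dephasing Lindbladian $$\mathcal L_x(\rho)=-i[H_x,\rho]-\gamma(x)\sum_{j\neq k}P_j(x)\,\rho\,P_k(x).$$ Then $P_0$ is differentiable on $[0,1]$, and, with $P_0'=dP_0/dx$, the mass term $$M(x)=\sum_{a\neq 0}\frac{\gamma(x)\,\mathrm{tr}\bigl(P_a(x)\,P_0'(x)^2\bigr)}{(e_0(x)-e_a(x))^2+\gamma(x)^2},$$ which depends only on the path $(H_x,\gamma(x))$ and not on any parametrization of it, satisfies $M(x)\ge 0$ on $[0,1]$. For every parametrization $q:[0,1]\to[0,1]$ of class $C^2$, the function $s\mapsto M(q(s))\,\dot q(s)^2$ is integrable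 on $[0,1]$; and if for $\varepsilon>0$ the matrix function $\rho_{q,\varepsilon}$ solves $\varepsilon\dot\rho(s)=\mathcal L_{q(s)}(\rho(s))$, $0\le s\le 1$, with initial condition $\rho(0)=P_0(q(0))$, then the tunneling $T_{q,\varepsilon}(s)=1-\mathrm{tr}\bigl(P_0(q(s))\rho_{q,\varepsilon}(s)\bigr)$ satisfies $$T_{q,\varepsilon}(1)=2\varepsilon\int_0^1 M(q(s))\,\dot q(s)^2\,ds+O(\varepsilon^2).$$ The error is uniform in the parametrization: for every $K$ there is a constant $C$ (depending only on $K$ and on the path $(H_x,\gamma(x))$) such that $$\Bigl|T_{q,\varepsilon}(1)-2\varepsilon\int_0^1 M(q(s))\,\dot q(s)^2\,ds\Bigr|\le C\varepsilon^2$$ for all $\varepsilon>0$ and all $C^2$ parametrizations $q:[0,1]\to[0,1]$ with $|\dot q|\le K$ and $|\ddot q|\le K$ on $[0,1]$. Every fixed $q$ satisfies such bounds for some $K$, and $q=q_\varepsilon$ may depend on $\varepsilon$ as long as $K$ does not. -/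

import Mathlib

open Set MeasureTheory
open scoped Matrix Matrix.Norms.Frobenius ContDiff

namespace Dephasing

noncomputable section

open Classical in
/-- The `a`-th eigenvalue `e_a` of a self-adjoint matrix `A`, the eigenvalues being counted with
multiplicity and listed in nondecreasing order `e_0 ≤ e_1 ≤ … ≤ e_{N-1}`. Mathlib's list
`eigenvalues₀` is nonincreasing, hence the reversal. (The value is `0` if `A` is not
self-adjoint.) -/
def energy {N : ℕ} (A : Matrix (Fin N) (Fin N) ℂ) (a : Fin N) : ℝ :=
  if hA : A.IsHermitian then hA.eigenvalues₀ (Fin.cast (Fintype.card_fin N).symm a.rev) else 0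

open Classical in
/-- The spectral projection `P_a` of a self-adjoint matrix `A` belonging to the eigenvalue `e_a`:
the functional calculus of `A` applied to the indicator function of `{e_a}`.
(The value is `0` if `A` is not self-adjoint.) -/
def specProj {N : ℕ} (A : Matrix (Fin N) (Fin N) ℂ) (a : Fin N) : Matrix (Fin N) (Fin N) ℂ :=
  if hA : A.IsHermitian then hA.cfc (fun x : ℝ => if x = energy A a then 1 else 0) else 0

/-- The dephasing Lindbladian
`ρ ↦ -i [A, ρ] - g ∑_{j ≠ k} P_j ρ P_k` of the Hamiltonian `A` with dephasing rate `g`. -/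
def lindbladian {N : ℕ} (A : Matrix (Fin N) (Fin N) ℂ) (g : ℝ) (ρ : Matrix (Fin N) (Fin N) ℂ) :
    Matrix (Fin N) (Fin N) ℂ :=
  -Complex.I • (A * ρ - ρ * A) -
    (g : ℂ) • ∑ j, ∑ k, if j ≠ k then specProj A j * ρ * specProj A k else 0

/-- `ρ` solves the adiabatic evolution equation `ε ρ̇(s) = L_{q(s)}(ρ(s))`, `0 ≤ s ≤ 1`, and starts
in the ground state `P_0` at the initial point of the path. -/
structure IsAdiabaticEvolution {N : ℕ} [NeZero N] (H : ℝ → Matrix (Fin N) (Fin N) ℂ) (γ : ℝ → ℝ)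
    (q : ℝ → ℝ) (ε : ℝ) (ρ : ℝ → Matrix (Fin N) (Fin N) ℂ) : Prop where
  init : ρ 0 = specProj (H (q 0)) 0
  evolve : ∀ s ∈ Icc (0 : ℝ) 1, ∃ v : Matrix (Fin N) (Fin N) ℂ,
    HasDerivWithinAt ρ v (Icc 0 1) s ∧ (ε : ℂ) • v = lindbladian (H (q s)) (γ (q s)) (ρ s)

/-- The tunneling `T(s) = 1 - tr (P_0(q(s)) ρ(s))`. -/
def tunneling {N : ℕ} [NeZero N] (H : ℝ → Matrix (Fin N) (Fin N) ℂ) (q : ℝ → ℝ)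
    (ρ : ℝ → Matrix (Fin N) (Fin N) ℂ) (s : ℝ) : ℝ :=
  1 - (specProj (H (q s)) 0 * ρ s).trace.re

/-- The derivative `P_0'(x)` of the ground state projection along the path `H_x`, `0 ≤ x ≤ 1`
(one-sided at the end points). -/
def groundProjDeriv {N : ℕ} [NeZero N] (H : ℝ → Matrix (Fin N) (Fin N) ℂ) (x : ℝ) :
    Matrix (Fin N) (Fin N) ℂ :=
  derivWithin (fun y => specProj (H y) 0) (Icc 0 1) x

/-- The mass term `M(x) = ∑_{a ≠ 0} γ tr (P_a P_0'²) / ((e_0 - e_a)² + γ²)`, a function of the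
point `x` of the path. -/
def mass {N : ℕ} [NeZero N] (H : ℝ → Matrix (Fin N) (Fin N) ℂ) (γ : ℝ → ℝ) (x : ℝ) : ℝ :=
  ∑ a ∈ Finset.univ.filter (fun a : Fin N => a ≠ 0),
    γ x * (specProj (H x) a * groundProjDeriv H x ^ 2).trace.re /
      ((energy (H x) 0 - energy (H x) a) ^ 2 + γ x ^ 2)

end

end Dephasing

/-! In the eigenbasis of `H_x` the Lindbladian acts blockwise: it multiplies `P_j ρ P_k` by `-i(e_j
- e_k) - γ(1 - δ_jk)`. Three facts follow. The state `P_0` is stationary and the functional `tr(P_0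
·)` is annihilated by `L`. All symbols have nonpositive real part, so `L` is dissipative in the
Frobenius norm. Off the diagonal the symbols are nonzero by the gap condition, so `L` and its
transpose `L*` can be inverted on `P_0'`, whose diagonal blocks vanish because `P_0` is idempotent.

Write `P(s) = P_0(q(s))` and `Y = q̇ (L*)⁻¹ P_0'`. Since `tr(P ρ̇) = 0`, the tunneling satisfies `Ṫ
= -tr(Ṗ ρ) = -ε tr(Y ρ̇)`. Integrating by parts, `T + ε tr(Y ρ)` has derivative `ε tr(Ẏ ρ)`.
Replacing `ρ` by `P` gives the leading term: `tr(Y P) = 0` implies `tr(Ẏ P) = -tr(Y Ṗ) = 2 M q̇²`.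
The replacement and the boundary term cost `O(ε²)` once `ρ - P = O(ε)` is known
(`abs_tunneling_sub_le`).

That last bound is an adiabatic theorem (`norm_sub_groundProj_le`): with `L B = Ṗ`, the remainder `r
= ρ - P - εB` solves `ṙ = ε⁻¹ L r - ε Ḃ`, and dissipativity makes the singular term harmless.

Uniformity in `q` holds because `L⁻¹ P_0'` and `(L*)⁻¹ P_0'` are `C¹` functions of `x` alone, so
that `q` enters only through bounds on its first two derivatives. Their regularity rests on that of
the simple eigenvalues and their projections (`contDiffOn_energy`, `contDiffOn_specProj`). -/

namespace Dephasing

/-! ### Eigenvalues and spectral projections of one matrix -/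

section Spectrum

variable {N : ℕ} {A : Matrix (Fin N) (Fin N) ℂ}

lemma monotone_energy (A : Matrix (Fin N) (Fin N) ℂ) : Monotone (energy A) := by
  intro a b hab
  unfold energy
  split_ifs with hA
  · apply hA.eigenvalues₀_antitone
    simpa [Fin.le_def] using Fin.rev_le_rev.mpr hab
  · exact le_rfl

lemma strictMono_energy (hinj : Function.Injective (energy A)) : StrictMono (energy A) :=
  (monotone_energy A).strictMono_of_injective hinj

/-- The two enumerations of the eigenvalues differ by a permutation. -/
lemma exists_perm_energy (hA : A.IsHermitian) :
    ∃ σ : Equiv.Perm (Fin N), ∀ i, hA.eigenvalues i = energy A (σ i) := by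
  refine ⟨((Fintype.equivOfCardEq (Fintype.card_fin _)).symm.trans
    (finCongr (Fintype.card_fin N))).trans Fin.revPerm, fun i => ?_⟩
  simp [energy, hA, Matrix.IsHermitian.eigenvalues]

lemma spectrum_eq_range_energy (hA : A.IsHermitian) : spectrum ℝ A = range (energy A) := by
  obtain ⟨σ, hσ⟩ := exists_perm_energy hA
  rw [hA.spectrum_real_eq_range_eigenvalues]
  have : hA.eigenvalues = energy A ∘ σ := funext hσ
  rw [this, σ.surjective.range_comp]

/-- A strictly increasing family of `N` eigenvalues is the ordered list of all eigenvalues. -/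
lemma energy_eq_of_strictMono (hA : A.IsHermitian) {f : Fin N → ℝ} (hf : StrictMono f)
    (hmem : ∀ a, f a ∈ spectrum ℝ A) : energy A = f := by
  classical
  rw [spectrum_eq_range_energy hA] at hmem
  have hsub : Finset.univ.image f ⊆ Finset.univ.image (energy A) := by
    intro y hy
    simp only [Finset.mem_image, Finset.mem_univ, true_and] at hy ⊢
    obtain ⟨a, rfl⟩ := hy
    exact hmem a
  have hcard : (Finset.univ.image f).card = N := by
    rw [Finset.card_image_of_injective _ hf.injective, Finset.card_univ, Fintype.card_fin]
  have hle : (Finset.univ.image (energy A)).card ≤ N := by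
    simpa using Finset.card_image_le (s := Finset.univ) (f := energy A)
  have heq := Finset.eq_of_subset_of_card_le hsub (by rw [hcard]; exact hle)
  have hinj : Function.Injective (energy A) := by
    rw [← Finset.card_image_iff.trans (by simp : InjOn (energy A) ↑(Finset.univ : Finset (Fin N)) ↔
      Function.Injective (energy A)), ← heq, hcard]
    simp
  have hrange : range (energy A) = range f := by
    have := congrArg (fun s : Finset ℝ => (s : Set ℝ)) heq
    simpa using this.symm
  exact (StrictMono.range_inj (strictMono_energy hinj) hf).mp hrange

lemma specProj_eq_cfc (hA : A.IsHermitian) (a : Fin N) :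
    specProj A a = cfc (fun x : ℝ => if x = energy A a then 1 else 0) A := by
  rw [hA.cfc_eq]
  simp only [specProj, hA, dif_pos]

/-- The spectrum is finite, hence discrete; this admits discontinuous indicator functions into the
continuous functional calculus. -/
lemma continuousOn_spectrum (f : ℝ → ℝ) (A : Matrix (Fin N) (Fin N) ℂ) :
    ContinuousOn f (spectrum ℝ A) :=
  A.finite_real_spectrum.continuousOn f

lemma specProj_mul_specProj (hA : A.IsHermitian) (hinj : Function.Injective (energy A))
    (a b : Fin N) : specProj A a * specProj A b = if a = b then specProj A a else 0 := by
  rw [specProj_eq_cfc hA, specProj_eq_cfc hA,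
    ← cfc_mul _ _ A (continuousOn_spectrum _ A) (continuousOn_spectrum _ A)]
  split_ifs with h
  · subst h
    congr 1
    ext x
    split_ifs <;> simp
  · convert cfc_const_zero ℝ A using 2
    ext x
    by_cases h1 : x = energy A a
    · have : x ≠ energy A b := fun h2 => h (hinj (h1.symm.trans h2))
      simp [this]
    · simp [h1]

lemma sum_specProj (hA : A.IsHermitian) (hinj : Function.Injective (energy A)) :
    ∑ a, specProj A a = 1 := by
  have hA' : IsSelfAdjoint A := hA
  simp_rw [specProj_eq_cfc hA]
  rw [← cfc_sum_univ _ A (fun i => continuousOn_spectrum _ A), ← cfc_one ℝ A hA']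
  apply cfc_congr
  intro x hx
  rw [spectrum_eq_range_energy hA] at hx
  obtain ⟨b, rfl⟩ := hx
  simp only [Finset.sum_apply, hinj.eq_iff]
  simp

lemma mul_specProj (hA : A.IsHermitian) (a : Fin N) :
    A * specProj A a = (energy A a : ℂ) • specProj A a := by
  have hA' : IsSelfAdjoint A := hA
  rw [specProj_eq_cfc hA]
  conv_lhs => enter [1]; rw [← cfc_id' ℝ A hA']
  rw [← cfc_mul _ _ A (continuousOn_spectrum _ A) (continuousOn_spectrum _ A)]
  rw [show ((energy A a : ℂ) • cfc (fun x : ℝ => if x = energy A a then (1 : ℝ) else 0) A) =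
    energy A a • cfc (fun x : ℝ => if x = energy A a then (1 : ℝ) else 0) A from by
      ext i j; simp,
    ← cfc_smul _ _ A (continuousOn_spectrum _ A)]
  congr 1
  ext x
  split_ifs with h <;> simp [h]

lemma isHermitian_specProj (hA : A.IsHermitian) (a : Fin N) : (specProj A a).IsHermitian := by
  rw [specProj_eq_cfc hA]
  exact cfc_predicate _ A

lemma specProj_mul (hA : A.IsHermitian) (a : Fin N) :
    specProj A a * A = (energy A a : ℂ) • specProj A a := by
  have h := congrArg Matrix.conjTranspose (mul_specProj hA a)
  rw [Matrix.conjTranspose_mul, Matrix.conjTranspose_smul, hA.eq,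
    (isHermitian_specProj hA a).eq] at h
  simpa using h

lemma trace_specProj (hA : A.IsHermitian) (hinj : Function.Injective (energy A)) (a : Fin N) :
    (specProj A a).trace = 1 := by
  obtain ⟨σ, hσ⟩ := exists_perm_energy hA
  rw [specProj_eq_cfc hA, hA.cfc_eq, Matrix.IsHermitian.cfc, Unitary.conjStarAlgAut_apply,
    Matrix.trace_mul_cycle]
  simp only [Unitary.star_mul_self_of_mem (SetLike.coe_mem _), one_mul,
    Matrix.trace_diagonal, Function.comp_apply, hσ, hinj.eq_iff]
  refine (Equiv.sum_comp σ
    (fun i => (RCLike.ofReal (if i = a then (1 : ℝ) else 0) : ℂ))).trans ?_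
  simp

/-- On the spectrum the Lagrange basis polynomial and the indicator of `e_a` coincide. The
polynomial form exhibits the regularity of the projection in the matrix and its eigenvalues. -/
lemma specProj_eq_aeval (hA : A.IsHermitian) (hinj : Function.Injective (energy A)) (a : Fin N) :
    specProj A a = Polynomial.aeval A (Lagrange.basis Finset.univ (energy A) a) := by
  have hA' : IsSelfAdjoint A := hA
  rw [specProj_eq_cfc hA, ← cfc_polynomial _ A hA']
  apply cfc_congr
  intro x hx
  rw [spectrum_eq_range_energy hA] at hx
  obtain ⟨b, rfl⟩ := hx
  by_cases h : b = a
  · subst h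
    simp [Lagrange.eval_basis_self (hinj.injOn) (Finset.mem_univ b)]
  · simp [hinj.eq_iff, h, Lagrange.eval_basis_of_ne (Ne.symm h) (Finset.mem_univ b)]

end Spectrum

/-! ### Regularity of eigenvalues and projections along the path -/

section Smoothness

variable {N : ℕ}

/-- The characteristic polynomial of `A`, as a real function of `A` and the spectral parameter. -/
noncomputable def reCharpoly (p : Matrix (Fin N) (Fin N) ℂ × ℝ) : ℝ :=
  (Matrix.det ((p.2 : ℂ) • (1 : Matrix (Fin N) (Fin N) ℂ) - p.1)).re

lemma contDiff_reCharpoly {n : ℕ∞} :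
    ContDiff ℝ n (reCharpoly : Matrix (Fin N) (Fin N) ℂ × ℝ → ℝ) := by
  unfold reCharpoly
  refine Complex.reCLM.contDiff.comp ?_
  simp_rw [Matrix.det_apply]
  refine ContDiff.sum fun σ _ => ?_
  refine ContDiff.const_smul _ (contDiff_prod fun i _ => ?_)
  have hentry : ContDiff ℝ n (fun p : Matrix (Fin N) (Fin N) ℂ × ℝ => p.1 (σ i) i) :=
    (Matrix.entryLinearMap ℝ ℂ (σ i) i).toContinuousLinearMap.contDiff.comp contDiff_fst
  have hscal : ContDiff ℝ n (fun p : Matrix (Fin N) (Fin N) ℂ × ℝ => (p.2 : ℂ)) :=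
    Complex.ofRealCLM.contDiff.comp contDiff_snd
  simpa using (hscal.mul contDiff_const).sub hentry

lemma det_smul_one_sub (A : Matrix (Fin N) (Fin N) ℂ) (hA : A.IsHermitian) (t : ℝ) :
    Matrix.det ((t : ℂ) • (1 : Matrix (Fin N) (Fin N) ℂ) - A) =
      ((∏ a, (t - energy A a) : ℝ) : ℂ) := by
  obtain ⟨σ, hσ⟩ := exists_perm_energy hA
  have h := Matrix.eval_charpoly A (t : ℂ)
  rw [hA.charpoly_eq, Polynomial.eval_prod] at h
  rw [Matrix.smul_one_eq_diagonal]
  have h2 : ∏ a, (t - energy A a) = ∏ i, (t - hA.eigenvalues i) := by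
    simp_rw [hσ]
    exact (Equiv.prod_comp σ (fun a => t - energy A a)).symm
  rw [h2]
  rw [Matrix.scalar_apply] at h
  simpa using h.symm

lemma reCharpoly_eq {A : Matrix (Fin N) (Fin N) ℂ} (hA : A.IsHermitian) (t : ℝ) :
    reCharpoly (A, t) = ∏ a, (t - energy A a) := by
  simp only [reCharpoly, det_smul_one_sub A hA, Complex.ofReal_re]

lemma mem_spectrum_of_reCharpoly_eq_zero {A : Matrix (Fin N) (Fin N) ℂ} (hA : A.IsHermitian)
    {t : ℝ} (h : reCharpoly (A, t) = 0) : t ∈ spectrum ℝ A := by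
  rw [reCharpoly_eq hA, Finset.prod_eq_zero_iff] at h
  obtain ⟨a, -, ha⟩ := h
  rw [spectrum_eq_range_energy hA]
  exact ⟨a, (sub_eq_zero.mp ha).symm⟩

lemma hasDerivAt_prod_sub {ι : Type*} [Fintype ι] {e : ι → ℝ} (he : Function.Injective e) (i : ι) :
    ∃ c ≠ 0, HasDerivAt (fun t => ∏ j, (t - e j)) c (e i) := by
  set p : Polynomial ℝ := ∏ j, (Polynomial.X - Polynomial.C (e j)) with hp
  have hsep : p.Separable := Polynomial.separable_prod_X_sub_C_iff.mpr he
  have heval : ∀ t, p.eval t = ∏ j, (t - e j) := fun t => by simp [hp, Polynomial.eval_prod]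
  refine ⟨p.derivative.eval (e i), ?_, ?_⟩
  · apply hsep.aeval_derivative_ne_zero
    rw [Polynomial.coe_aeval_eq_eval, heval]
    exact Finset.prod_eq_zero (Finset.mem_univ i) (sub_self _)
  · simpa only [heval] using p.hasDerivAt (e i)

/-- Simple roots have nonzero derivative: this is the nondegeneracy that the implicit function
theorem requires. -/
lemma isInvertible_fderiv_reCharpoly {A : Matrix (Fin N) (Fin N) ℂ} (hA : A.IsHermitian)
    (hinj : Function.Injective (energy A)) (a : Fin N) :
    (fderiv ℝ reCharpoly (A, energy A a) ∘L
      .inr ℝ (Matrix (Fin N) (Fin N) ℂ) ℝ).IsInvertible := by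
  obtain ⟨c, hc, hderiv⟩ := hasDerivAt_prod_sub hinj a
  have hdiff : DifferentiableAt ℝ reCharpoly (A, energy A a) :=
    (contDiff_reCharpoly (n := 1)).differentiable (by simp) _
  have hcomp : HasDerivAt (fun t => reCharpoly (A, t))
      (fderiv ℝ reCharpoly (A, energy A a) (0, 1)) (energy A a) :=
    hdiff.hasFDerivAt.comp_hasDerivAt _ ((hasDerivAt_const _ A).prodMk (hasDerivAt_id _))
  simp_rw [reCharpoly_eq hA] at hcomp
  have h1 := hcomp.unique hderiv
  refine ⟨ContinuousLinearEquiv.smulLeft (Units.mk0 c hc), ?_⟩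
  ext
  simp [h1]

/-- Near a self-adjoint matrix with simple spectrum the ordered eigenvalues of self-adjoint
matrices are smooth functions of the matrix. -/
lemma exists_contDiffAt_energy {A : Matrix (Fin N) (Fin N) ℂ} (hA : A.IsHermitian)
    (hinj : Function.Injective (energy A)) :
    ∃ f : Fin N → Matrix (Fin N) (Fin N) ℂ → ℝ, (∀ a, ContDiffAt ℝ 2 (f a) A) ∧
      ∀ᶠ B in nhds A, B.IsHermitian → ∀ a, energy B a = f a B := by
  have cdf : ∀ a, ContDiffAt ℝ 2 reCharpoly (A, energy A a) := fun a =>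
    (contDiff_reCharpoly (n := 2)).contDiffAt
  have hinv := isInvertible_fderiv_reCharpoly hA hinj
  set f : Fin N → Matrix (Fin N) (Fin N) ℂ → ℝ := fun a =>
    (cdf a).implicitFunction two_ne_zero (hinv a) with hf
  have hf0 : ∀ a, f a A = energy A a := fun a =>
    (cdf a).implicitFunction_apply_self two_ne_zero (hinv a)
  have hsm : ∀ a, ContDiffAt ℝ 2 (f a) A := fun a =>
    (cdf a).contDiffAt_implicitFunction two_ne_zero (hinv a)
  refine ⟨f, hsm, ?_⟩
  have hroot : ∀ᶠ B in nhds A, ∀ a, reCharpoly (B, f a B) = 0 := by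
    rw [Filter.eventually_all]
    intro a
    filter_upwards [(cdf a).eventually_apply_implicitFunction two_ne_zero (hinv a)] with B hB
    rw [hf]
    simp only
    rw [hB, reCharpoly_eq hA]
    exact Finset.prod_eq_zero (Finset.mem_univ a) (sub_self _)
  -- The strict order of the implicit roots at `A` persists nearby, so they are `N` distinct
  -- eigenvalues in the right order and exhaust the spectrum.
  have hlt : ∀ᶠ B in nhds A, ∀ a b, a < b → f a B < f b B := by
    rw [Filter.eventually_all]
    intro a
    rw [Filter.eventually_all]
    intro b
    rw [Filter.eventually_imp_distrib_left]
    intro hab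
    apply (hsm a).continuousAt.eventually_lt (hsm b).continuousAt
    rw [hf0, hf0]
    exact strictMono_energy hinj hab
  filter_upwards [hroot, hlt] with B hB1 hB2 hB a
  rw [energy_eq_of_strictMono hB (fun a b hab => hB2 a b hab)
    fun a => mem_spectrum_of_reCharpoly_eq_zero hB (hB1 a)]

variable {H : ℝ → Matrix (Fin N) (Fin N) ℂ} {s : Set ℝ}

lemma contDiffOn_energy (hH : ContDiffOn ℝ 2 H s) (hHerm : ∀ x ∈ s, (H x).IsHermitian)
    (hinj : ∀ x ∈ s, Function.Injective (energy (H x))) (a : Fin N) :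
    ContDiffOn ℝ 2 (fun x => energy (H x) a) s := by
  intro x hx
  obtain ⟨f, hf, hev⟩ := exists_contDiffAt_energy (hHerm x hx) (hinj x hx)
  have hcomp : ContDiffWithinAt ℝ 2 (fun y => f a (H y)) s x :=
    (hf a).comp_contDiffWithinAt x (hH x hx)
  refine hcomp.congr_of_eventuallyEq ?_ (hev.self_of_nhds (hHerm x hx) a)
  filter_upwards [(hH x hx).continuousWithinAt.eventually hev, self_mem_nhdsWithin] with y hy hys
  exact hy (hHerm y hys) a

lemma contDiffOn_specProj (hH : ContDiffOn ℝ 2 H s) (hHerm : ∀ x ∈ s, (H x).IsHermitian)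
    (hinj : ∀ x ∈ s, Function.Injective (energy (H x))) (a : Fin N) :
    ContDiffOn ℝ 2 (fun x => specProj (H x) a) s := by
  have hE := contDiffOn_energy hH hHerm hinj
  -- Induction on the factors of the Lagrange polynomial; `a ∉ t` keeps every denominator `e_a -
  -- e_b` nonzero.
  suffices h : ∀ t : Finset (Fin N), a ∉ t → ContDiffOn ℝ 2 (fun x => Polynomial.aeval (H x)
      (∏ b ∈ t, Lagrange.basisDivisor (energy (H x) a) (energy (H x) b))) s from
    (h (Finset.univ.erase a) (Finset.notMem_erase _ _)).congr fun x hx =>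
      specProj_eq_aeval (hHerm x hx) (hinj x hx) a
  intro t
  induction t using Finset.induction_on with
  | empty => intro _; simpa using contDiffOn_const
  | insert b t hb ih =>
    intro ha
    rw [Finset.mem_insert, not_or] at ha
    simp_rw [Finset.prod_insert hb, map_mul]
    refine ContDiffOn.mul ?_ (ih ha.2)
    have h1 : ContDiffOn ℝ 2 (fun x => (energy (H x) a - energy (H x) b)⁻¹) s :=
      ((hE a).sub (hE b)).inv fun x hx h => ha.1 (hinj x hx (sub_eq_zero.mp h))
    refine (h1.smul (hH.sub ((hE b).smul
      (contDiffOn_const (c := (1 : Matrix (Fin N) (Fin N) ℂ)))))).congr fun x _ => ?_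
    simp [Lagrange.basisDivisor, Algebra.smul_def]

end Smoothness

/-! ### Schur multipliers with respect to a family of projections -/

section SchurMultiplier

variable {N : ℕ} {P : Fin N → Matrix (Fin N) (Fin N) ℂ}

/-- The Schur multiplier with symbol `c` with respect to the blocks of a family of projections. -/
noncomputable def schurMul (P : Fin N → Matrix (Fin N) (Fin N) ℂ) (c : Fin N → Fin N → ℂ)
    (X : Matrix (Fin N) (Fin N) ℂ) : Matrix (Fin N) (Fin N) ℂ :=
  ∑ j, ∑ k, c j k • (P j * X * P k)

lemma mul_schurMul_mul (hP : ∀ a b, P a * P b = if a = b then P a else 0)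
    (c : Fin N → Fin N → ℂ) (X : Matrix (Fin N) (Fin N) ℂ) (j k : Fin N) :
    P j * schurMul P c X * P k = c j k • (P j * X * P k) := by
  have h : ∀ j' k', P j * (c j' k' • (P j' * X * P k')) * P k =
      if j = j' then (if k' = k then c j k • (P j * X * P k) else 0) else 0 := by
    intro j' k'
    have : P j * (c j' k' • (P j' * X * P k')) * P k =
        c j' k' • ((P j * P j') * X * (P k' * P k)) := by
      simp only [mul_smul_comm, smul_mul_assoc, mul_assoc]
    rw [this, hP, hP]
    split_ifs with h1 h2
    · rw [h1, h2]
    · simp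
    · simp
    · simp
  simp_rw [schurMul, Finset.mul_sum, Finset.sum_mul, h]
  simp

lemma schurMul_schurMul (hP : ∀ a b, P a * P b = if a = b then P a else 0)
    (c d : Fin N → Fin N → ℂ) (X : Matrix (Fin N) (Fin N) ℂ) :
    schurMul P c (schurMul P d X) = schurMul P (fun j k => c j k * d j k) X := by
  conv_lhs => rw [schurMul]
  simp_rw [mul_schurMul_mul hP, smul_smul]
  rfl

lemma schurMul_one (hsum : ∑ a, P a = 1) (X : Matrix (Fin N) (Fin N) ℂ) :
    schurMul P (fun _ _ => 1) X = X := by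
  simp_rw [schurMul, one_smul, ← Finset.mul_sum, ← Finset.sum_mul, hsum, one_mul, mul_one]

/-- Symbols matter only on nonzero blocks of `X`. This permits inverting a symbol that vanishes on
the diagonal. -/
lemma schurMul_congr {c d : Fin N → Fin N → ℂ} {X : Matrix (Fin N) (Fin N) ℂ}
    (h : ∀ j k, c j k = d j k ∨ P j * X * P k = 0) : schurMul P c X = schurMul P d X := by
  refine Finset.sum_congr rfl fun j _ => Finset.sum_congr rfl fun k _ => ?_
  rcases h j k with h | h <;> simp [h]

/-- By cyclicity of the trace, transposing the symbol gives the transpose for the bilinear pairing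
`tr(XY)`. -/
lemma trace_schurMul_mul (c : Fin N → Fin N → ℂ) (X Y : Matrix (Fin N) (Fin N) ℂ) :
    (schurMul P c X * Y).trace = (X * schurMul P (fun j k => c k j) Y).trace := by
  simp only [schurMul, Finset.sum_mul, Finset.mul_sum, Matrix.trace_sum, smul_mul_assoc,
    mul_smul_comm, Matrix.trace_smul]
  rw [Finset.sum_comm]
  refine Finset.sum_congr rfl fun j _ => Finset.sum_congr rfl fun k _ => ?_
  rw [show P k * X * P j * Y = P k * (X * P j * Y) by simp only [mul_assoc], Matrix.trace_mul_comm]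
  simp only [mul_assoc]

lemma schurMul_sub (c : Fin N → Fin N → ℂ) (X Y : Matrix (Fin N) (Fin N) ℂ) :
    schurMul P c (X - Y) = schurMul P c X - schurMul P c Y := by
  simp only [schurMul, mul_sub, sub_mul, smul_sub, Finset.sum_sub_distrib]

lemma schurMul_smul (c : Fin N → Fin N → ℂ) (t : ℂ) (X : Matrix (Fin N) (Fin N) ℂ) :
    schurMul P c (t • X) = t • schurMul P c X := by
  simp only [schurMul, mul_smul_comm, smul_mul_assoc, Finset.smul_sum]
  simp_rw [smul_comm t]

lemma re_trace_conjTranspose_mul_self (X : Matrix (Fin N) (Fin N) ℂ) :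
    (Xᴴ * X).trace.re = ‖X‖ ^ 2 := by
  have h0 : 0 ≤ ∑ i, ∑ j, ‖X i j‖ ^ (2 : ℝ) := by positivity
  rw [Matrix.frobenius_norm_def, ← Real.sqrt_eq_rpow, Real.sq_sqrt h0, Matrix.trace,
    Finset.sum_comm, Complex.re_sum]
  refine Finset.sum_congr rfl fun i _ => ?_
  rw [Matrix.diag_apply, Matrix.mul_apply, Complex.re_sum]
  refine Finset.sum_congr rfl fun j _ => ?_
  rw [Matrix.conjTranspose_apply, Real.rpow_two, Complex.star_def, ← Complex.normSq_eq_conj_mul_self,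
    Complex.ofReal_re, Complex.normSq_eq_norm_sq]

/-- A Schur multiplier whose symbol has nonpositive real part is dissipative. -/
lemma re_trace_conjTranspose_mul_schurMul_nonpos
    (hP : ∀ a b, P a * P b = if a = b then P a else 0) (hherm : ∀ a, (P a).IsHermitian)
    {c : Fin N → Fin N → ℂ} (hc : ∀ j k, (c j k).re ≤ 0) (X : Matrix (Fin N) (Fin N) ℂ) :
    (Xᴴ * schurMul P c X).trace.re ≤ 0 := by
  simp only [schurMul, Finset.mul_sum, Matrix.trace_sum, mul_smul_comm, Matrix.trace_smul,
    Complex.re_sum]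
  refine Finset.sum_nonpos fun j _ => Finset.sum_nonpos fun k _ => ?_
  -- Each block contributes its symbol times the squared Frobenius norm of `P_j X P_k`.
  have h : (Xᴴ * (P j * X * P k)).trace = ((P j * X * P k)ᴴ * (P j * X * P k)).trace := by
    have hj : P j * P j = P j := by simp [hP]
    have hk : P k * P k = P k := by simp [hP]
    calc (Xᴴ * (P j * X * P k)).trace = (Xᴴ * (P j * P j) * X * (P k * P k)).trace := by
          rw [hj, hk]; simp only [mul_assoc]
      _ = ((Xᴴ * (P j * P j) * X * P k) * P k).trace := by simp only [mul_assoc]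
      _ = (P k * (Xᴴ * (P j * P j) * X * P k)).trace := Matrix.trace_mul_comm _ _
      _ = _ := by
        rw [Matrix.conjTranspose_mul, Matrix.conjTranspose_mul, (hherm j).eq, (hherm k).eq]
        simp only [mul_assoc]
  have him : ((P j * X * P k)ᴴ * (P j * X * P k)).trace.im = 0 := by
    have h1 := Matrix.trace_conjTranspose ((P j * X * P k)ᴴ * (P j * X * P k))
    rw [Matrix.conjTranspose_mul, Matrix.conjTranspose_conjTranspose] at h1
    exact Complex.conj_eq_iff_im.mp h1.symm
  rw [smul_eq_mul, h, Complex.mul_re, him, mul_zero, sub_zero, re_trace_conjTranspose_mul_self]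
  exact mul_nonpos_of_nonpos_of_nonneg (hc j k) (by positivity)

variable [NeZero N] {X : Matrix (Fin N) (Fin N) ℂ}

/-- The relation for `X` multiplies the block `(j, k)` by `δ_j0 + δ_k0`, which is `2` or `0` here
and never `1`. -/
lemma block_eq_zero (hP : ∀ a b, P a * P b = if a = b then P a else 0)
    (hX : X = P 0 * X + X * P 0) {j k : Fin N} (h : j = 0 ↔ k = 0) : P j * X * P k = 0 := by
  have h1 : P j * X * P k = P j * P 0 * X * P k + P j * X * (P 0 * P k) := by
    conv_lhs => rw [hX]
    simp only [mul_add, add_mul, mul_assoc]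
  rw [hP, hP] at h1
  by_cases hj : j = 0
  · have hk := h.mp hj
    subst hj
    subst hk
    simpa using h1
  · have hk : ¬ (0 = k) := fun hk => hj (h.mpr hk.symm)
    simpa [hj, hk] using h1

/-- Only the blocks `(a, 0)` and `(0, a)` of `X` survive, and both yield the trace of `P_a X²`. -/
lemma trace_schurMul_mul_self (hP : ∀ a b, P a * P b = if a = b then P a else 0)
    (hX : X = P 0 * X + X * P 0) (c : Fin N → Fin N → ℂ) :
    (schurMul P c X * X).trace =
      ∑ a ∈ Finset.univ.filter (fun a : Fin N => a ≠ 0),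
        (c a 0 + c 0 a) * (P a * X ^ 2).trace := by
  have h0 : ∀ a, a ≠ 0 → P a * X = P a * X * P 0 := by
    intro a ha
    conv_lhs => rw [hX, mul_add, ← mul_assoc, hP, if_neg ha, zero_mul, zero_add, ← mul_assoc]
  have h1 : ∀ a, a ≠ 0 → (P a * X * P 0 * X).trace = (P a * X ^ 2).trace := by
    intro a ha
    rw [← h0 a ha, sq, mul_assoc]
  have h2 : ∀ a, a ≠ 0 → (P 0 * X * P a * X).trace = (P a * X ^ 2).trace := by
    intro a ha
    rw [← h1 a ha, mul_assoc, Matrix.trace_mul_comm]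
    simp only [mul_assoc]
  have h3 : ∀ j k, c j k * (P j * X * P k * X).trace =
      (if k = 0 then (if j ≠ 0 then c j 0 * (P j * X ^ 2).trace else 0) else 0) +
      (if j = 0 then (if k ≠ 0 then c 0 k * (P k * X ^ 2).trace else 0) else 0) := by
    intro j k
    by_cases hj : j = 0 <;> by_cases hk : k = 0
    · rw [block_eq_zero hP hX (by simp [hj, hk])]
      simp [hj, hk]
    · subst hj
      simp [hk, h2 k hk]
    · subst hk
      simp [hj, h1 j hj]
    · rw [block_eq_zero hP hX (by simp [hj, hk])]
      simp [hj, hk]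
  simp only [schurMul, Finset.sum_mul, Matrix.trace_sum, smul_mul_assoc, Matrix.trace_smul,
    smul_eq_mul]
  simp_rw [h3, Finset.sum_add_distrib]
  rw [Finset.sum_comm (f := fun j k => if j = 0 then
    (if k ≠ 0 then c 0 k * (P k * X ^ 2).trace else 0) else 0)]
  simp only [Finset.sum_ite_eq', Finset.mem_univ, if_true]
  rw [← Finset.sum_filter, ← Finset.sum_filter, ← Finset.sum_add_distrib]
  simp_rw [add_mul]

end SchurMultiplier

/-! ### The Lindbladian as a Schur multiplier -/

section Lindbladian

variable {N : ℕ} {A : Matrix (Fin N) (Fin N) ℂ}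

/-- The eigenvalues of the dephasing Lindbladian. -/
noncomputable def rate (A : Matrix (Fin N) (Fin N) ℂ) (g : ℝ) (j k : Fin N) : ℂ :=
  -Complex.I * (energy A j - energy A k) - if j ≠ k then (g : ℂ) else 0

lemma rate_self (g : ℝ) (j : Fin N) : rate A g j j = 0 := by simp [rate]

/-- The imaginary part is the spectral gap, so invertibility does not need dephasing: `g = 0` is
allowed. -/
lemma rate_ne_zero (hinj : Function.Injective (energy A)) (g : ℝ) {j k : Fin N} (h : j ≠ k) :
    rate A g j k ≠ 0 := by
  intro h0
  have him := congrArg Complex.im h0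
  simp only [rate, if_pos h] at him
  simp at him
  exact h (hinj (by linarith))

lemma re_rate_nonpos {g : ℝ} (hg : 0 ≤ g) (j k : Fin N) : (rate A g j k).re ≤ 0 := by
  by_cases h : j = k
  · simp [rate, h]
  · simp [rate, h, hg]

/-- The two rates are complex conjugates, so the sum is twice the real part of an inverse. This is
the source of the denominators of the mass term. -/
lemma inv_rate_add_inv_rate (g : ℝ) {j k : Fin N} (h : j ≠ k) :
    (rate A g k j)⁻¹ + (rate A g j k)⁻¹ =
      ((-(2 * g) / ((energy A k - energy A j) ^ 2 + g ^ 2) : ℝ) : ℂ) := by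
  have hconj : rate A g j k = (starRingEnd ℂ) (rate A g k j) := by
    simp only [rate, if_pos h, if_pos h.symm]
    apply Complex.ext <;> simp
  have hn : Complex.normSq (rate A g k j) = (energy A k - energy A j) ^ 2 + g ^ 2 := by
    simp only [rate, if_pos h.symm]
    simp [Complex.normSq_apply]
    ring
  rw [hconj, ← map_inv₀, Complex.add_conj, Complex.inv_re, hn]
  congr 1
  simp [rate, h.symm]
  ring

/-- Insert `∑ P_a = 1` on both sides of `ρ` and use `A P_a = e_a P_a = P_a A`. -/
lemma lindbladian_eq_schurMul (hA : A.IsHermitian) (hinj : Function.Injective (energy A)) (g : ℝ)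
    (ρ : Matrix (Fin N) (Fin N) ℂ) :
    lindbladian A g ρ = schurMul (specProj A) (rate A g) ρ := by
  have hsum := sum_specProj hA hinj
  have h1 : A * ρ = ∑ j, ∑ k, (energy A j : ℂ) • (specProj A j * ρ * specProj A k) := by
    simp_rw [← Finset.smul_sum, ← Finset.mul_sum, hsum, mul_one, ← smul_mul_assoc,
      ← mul_specProj hA, ← Finset.sum_mul, ← Finset.mul_sum, hsum, mul_one]
  have h2 : ρ * A = ∑ j, ∑ k, (energy A k : ℂ) • (specProj A j * ρ * specProj A k) := by
    simp_rw [← mul_smul_comm, ← specProj_mul hA, ← Finset.mul_sum, ← Finset.sum_mul, hsum, one_mul]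
  rw [lindbladian, h1, h2, ← Finset.sum_sub_distrib]
  simp_rw [← Finset.sum_sub_distrib, Finset.smul_sum]
  rw [← Finset.sum_sub_distrib, schurMul]
  refine Finset.sum_congr rfl fun j _ => ?_
  rw [← Finset.sum_sub_distrib]
  refine Finset.sum_congr rfl fun k _ => ?_
  rw [rate]
  split_ifs with h
  · module
  · simp only [smul_zero, sub_zero]
    module

end Lindbladian

/-! ### Trace estimates and a Gronwall bound -/

section RealTrace

variable {N : ℕ}

/-- The real part of the trace, as a continuous linear functional. -/
noncomputable def reTrace (N : ℕ) : Matrix (Fin N) (Fin N) ℂ →L[ℝ] ℝ :=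
  Complex.reCLM ∘L (Matrix.traceLinearMap (Fin N) ℝ ℂ).toContinuousLinearMap

lemma norm_entry_le_frobenius_norm (X : Matrix (Fin N) (Fin N) ℂ) (i j : Fin N) :
    ‖X i j‖ ≤ ‖X‖ := by
  rw [Matrix.frobenius_norm_def, ← Real.sqrt_eq_rpow]
  refine Real.le_sqrt_of_sq_le ?_
  rw [← Real.rpow_two]
  have h0 : ∀ k l, 0 ≤ ‖X k l‖ ^ (2 : ℝ) := fun k l => by positivity
  exact (Finset.single_le_sum (f := fun l => ‖X i l‖ ^ (2 : ℝ)) (fun l _ => h0 i l)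
    (Finset.mem_univ j)).trans (Finset.single_le_sum (f := fun k => ∑ l, ‖X k l‖ ^ (2 : ℝ))
    (fun k _ => Finset.sum_nonneg fun l _ => h0 k l) (Finset.mem_univ i))

lemma abs_re_trace_le (X : Matrix (Fin N) (Fin N) ℂ) : |X.trace.re| ≤ N * ‖X‖ := by
  refine (Complex.abs_re_le_norm _).trans ((norm_sum_le _ _).trans ?_)
  refine (Finset.sum_le_card_nsmul _ _ ‖X‖ fun i _ => norm_entry_le_frobenius_norm X i i).trans ?_
  simp

lemma abs_re_trace_mul_le (X Y : Matrix (Fin N) (Fin N) ℂ) :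
    |(X * Y).trace.re| ≤ N * (‖X‖ * ‖Y‖) :=
  (abs_re_trace_le (X * Y)).trans
    (mul_le_mul_of_nonneg_left (Matrix.frobenius_norm_mul X Y) (Nat.cast_nonneg _))

lemma hasDerivWithinAt_re_trace_mul {X Y : ℝ → Matrix (Fin N) (Fin N) ℂ}
    {X' Y' : Matrix (Fin N) (Fin N) ℂ} {s : Set ℝ} {x : ℝ} (hX : HasDerivWithinAt X X' s x)
    (hY : HasDerivWithinAt Y Y' s x) :
    HasDerivWithinAt (fun y => (X y * Y y).trace.re)
      ((X' * Y x).trace.re + (X x * Y').trace.re) s x := by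
  have h := (reTrace N).hasFDerivAt.comp_hasDerivWithinAt x (hX.mul hY)
  rwa [show (X' * Y x).trace.re + (X x * Y').trace.re = reTrace N (X' * Y x + X x * Y') from
    ((congrArg Complex.re (Matrix.trace_add _ _)).trans (Complex.add_re _ _)).symm]

/-- A Gronwall type estimate in the Frobenius norm, for a dissipative evolution with a bounded
inhomogeneity. -/
lemma norm_le_of_re_trace_deriv_le {r r' : ℝ → Matrix (Fin N) (Fin N) ℂ} {κ : ℝ}
    (hr : ∀ s ∈ Icc (0 : ℝ) 1, HasDerivWithinAt r (r' s) (Icc 0 1) s)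
    (hκ : ∀ s ∈ Icc (0 : ℝ) 1, ((r s)ᴴ * r' s).trace.re ≤ κ * ‖r s‖) (hκ0 : 0 ≤ κ)
    {s : ℝ} (hs : s ∈ Icc (0 : ℝ) 1) : ‖r s‖ ≤ ‖r 0‖ + κ := by
  refine le_of_forall_pos_le_add fun η hη => ?_
  -- The norm need not be differentiable where `r` vanishes; adding `η²` under the root repairs
  -- this, and `η` is arbitrary.
  set g : ℝ → ℝ := fun t => √(((r t)ᴴ * r t).trace.re + η ^ 2) with hg
  have hpos : ∀ t, 0 < ((r t)ᴴ * r t).trace.re + η ^ 2 := fun t => by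
    rw [re_trace_conjTranspose_mul_self]; positivity
  have hge : ∀ t, ‖r t‖ ≤ g t := fun t => by
    rw [hg]
    refine Real.le_sqrt_of_sq_le ?_
    rw [re_trace_conjTranspose_mul_self]
    nlinarith
  have hderiv : ∀ t ∈ Icc (0 : ℝ) 1, HasDerivWithinAt g
      ((2 * ((r t)ᴴ * r' t).trace.re) / (2 * g t)) (Icc 0 1) t := by
    intro t ht
    have hstar : HasDerivWithinAt (fun t => (r t)ᴴ) (r' t)ᴴ (Icc 0 1) t := (hr t ht).star
    have h := ((hasDerivWithinAt_re_trace_mul hstar (hr t ht)).add_const (η ^ 2)).sqrt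
      (hpos t).ne'
    convert h using 2
    have : ((r' t)ᴴ * r t).trace.re = ((r t)ᴴ * r' t).trace.re := by
      have h1 := Matrix.trace_conjTranspose ((r t)ᴴ * r' t)
      rw [Matrix.conjTranspose_mul, Matrix.conjTranspose_conjTranspose] at h1
      rw [h1]
      simp
    rw [this, two_mul]
  have hanti : AntitoneOn (fun t => g t - κ * t) (Icc 0 1) := by
    have hd : ∀ t ∈ Icc (0 : ℝ) 1, HasDerivWithinAt (fun t => g t - κ * t)
        ((2 * ((r t)ᴴ * r' t).trace.re) / (2 * g t) - κ * 1) (Icc 0 1) t := fun t ht =>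
      (hderiv t ht).sub ((hasDerivWithinAt_id _ _).const_mul κ)
    refine antitoneOn_of_hasDerivWithinAt_nonpos (convex_Icc 0 1)
      (fun t ht => (hd t ht).continuousWithinAt)
      (fun t ht => (hd t (interior_subset ht)).mono interior_subset) fun t ht => ?_
    have ht' := interior_subset ht
    have hgpos : 0 < g t := Real.sqrt_pos.mpr (hpos t)
    have : (2 * ((r t)ᴴ * r' t).trace.re) / (2 * g t) ≤ κ := by
      rw [div_le_iff₀ (by positivity)]
      have h1 := hκ t ht'
      have h2 := mul_le_mul_of_nonneg_left (hge t) hκ0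
      linarith
    linarith
  have h0 : g 0 ≤ ‖r 0‖ + η := by
    rw [hg]
    refine Real.sqrt_le_iff.mpr ⟨by positivity, ?_⟩
    rw [re_trace_conjTranspose_mul_self]
    nlinarith [norm_nonneg (r 0)]
  have h1 := hanti (left_mem_Icc.mpr zero_le_one) hs hs.1
  simp only [mul_zero, sub_zero] at h1
  have h2 : κ * s ≤ κ * 1 := mul_le_mul_of_nonneg_left hs.2 hκ0
  linarith [hge s]

end RealTrace

/-! ### Correctors and the mass term -/

section Path

variable {N : ℕ} {H : ℝ → Matrix (Fin N) (Fin N) ℂ} {γ : ℝ → ℝ}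

lemma contDiffOn_schurMul {s : Set ℝ} {n : ℕ∞} {P : ℝ → Fin N → Matrix (Fin N) (Fin N) ℂ}
    {c : ℝ → Fin N → Fin N → ℂ} {X : ℝ → Matrix (Fin N) (Fin N) ℂ}
    (hP : ∀ a, ContDiffOn ℝ n (fun x => P x a) s) (hc : ∀ j k, ContDiffOn ℝ n (fun x => c x j k) s)
    (hX : ContDiffOn ℝ n X s) : ContDiffOn ℝ n (fun x => schurMul (P x) (c x) (X x)) s :=
  ContDiffOn.sum fun j _ => ContDiffOn.sum fun k _ =>
    (hc j k).smul (((hP j).mul hX).mul (hP k))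

lemma contDiffOn_inv_rate {s : Set ℝ} {n : ℕ∞}
    (hinj : ∀ x ∈ s, Function.Injective (energy (H x)))
    (hE : ∀ a, ContDiffOn ℝ n (fun x => energy (H x) a) s)
    (hγ : ContDiffOn ℝ n γ s) (j k : Fin N) :
    ContDiffOn ℝ n (fun x => (rate (H x) (γ x) j k)⁻¹) s := by
  by_cases h : j = k
  · subst h
    simp_rw [rate_self]
    exact contDiffOn_const
  · refine ContDiffOn.inv ?_ fun x hx => rate_ne_zero (hinj x hx) _ h
    simp only [rate, if_pos (show j ≠ k from h)]
    have hof : ∀ {f : ℝ → ℝ}, ContDiffOn ℝ n f s → ContDiffOn ℝ n (fun x => (f x : ℂ)) s :=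
      fun hf => Complex.ofRealCLM.contDiff.comp_contDiffOn hf
    exact (contDiffOn_const.mul ((hof (hE j)).sub (hof (hE k)))).sub (hof hγ)

lemma re_trace_conjTranspose_mul_lindbladian_nonpos {x : ℝ} (hA : (H x).IsHermitian)
    (hinj : Function.Injective (energy (H x)))
    {g : ℝ} (hg : 0 ≤ g)
    (X : Matrix (Fin N) (Fin N) ℂ) : (Xᴴ * lindbladian (H x) g X).trace.re ≤ 0 := by
  rw [lindbladian_eq_schurMul hA hinj]
  exact re_trace_conjTranspose_mul_schurMul_nonpos (specProj_mul_specProj hA hinj)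
    (isHermitian_specProj hA) (re_rate_nonpos hg) X

variable [NeZero N]

lemma hasDerivWithinAt_groundProj
    (hP : ∀ a, ContDiffOn ℝ 2 (fun x => specProj (H x) a) (Icc 0 1)) {x : ℝ}
    (hx : x ∈ Icc (0 : ℝ) 1) :
    HasDerivWithinAt (fun y => specProj (H y) 0) (groundProjDeriv H x) (Icc 0 1) x :=
  ((hP 0).differentiableOn two_ne_zero x hx).hasDerivWithinAt

lemma contDiffOn_groundProjDeriv
    (hP : ∀ a, ContDiffOn ℝ 2 (fun x => specProj (H x) a) (Icc 0 1)) :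
    ContDiffOn ℝ 1 (groundProjDeriv H) (Icc 0 1) :=
  (hP 0).derivWithin (uniqueDiffOn_Icc zero_lt_one) (by norm_num)

lemma uniqueDiffWithinAt_unitInterval {x : ℝ} (hx : x ∈ Icc (0 : ℝ) 1) :
    UniqueDiffWithinAt ℝ (Icc 0 1) x := uniqueDiffOn_Icc zero_lt_one x hx

/-- The product rule applied to `P_0² = P_0`. -/
lemma groundProjDeriv_eq (hHerm : ∀ x ∈ Icc (0 : ℝ) 1, (H x).IsHermitian)
    (hinj : ∀ x ∈ Icc (0 : ℝ) 1, Function.Injective (energy (H x)))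
    (hP : ∀ a, ContDiffOn ℝ 2 (fun x => specProj (H x) a) (Icc 0 1)) {x : ℝ}
    (hx : x ∈ Icc (0 : ℝ) 1) :
    groundProjDeriv H x =
      specProj (H x) 0 * groundProjDeriv H x + groundProjDeriv H x * specProj (H x) 0 := by
  have h := hasDerivWithinAt_groundProj hP hx
  have h2 := (h.mul h).congr_of_mem (f₁ := fun y => specProj (H y) 0)
    (fun y hy => by simp [specProj_mul_specProj (hHerm y hy) (hinj y hy)]) hx
  rw [add_comm]
  exact (uniqueDiffWithinAt_unitInterval hx).eq_deriv _ h h2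

lemma isHermitian_groundProjDeriv (hHerm : ∀ x ∈ Icc (0 : ℝ) 1, (H x).IsHermitian)
    (hP : ∀ a, ContDiffOn ℝ 2 (fun x => specProj (H x) a) (Icc 0 1)) {x : ℝ}
    (hx : x ∈ Icc (0 : ℝ) 1) : (groundProjDeriv H x).IsHermitian := by
  have h := hasDerivWithinAt_groundProj hP hx
  have h2 := h.star.congr_of_mem (f₁ := fun y => specProj (H y) 0)
    (fun y hy => (isHermitian_specProj (hHerm y hy) 0).symm) hx
  exact ((uniqueDiffWithinAt_unitInterval hx).eq_deriv _ h h2).symm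

/-- The solution `B` of `L B = P_0'` without diagonal blocks. -/
noncomputable def corrector (H : ℝ → Matrix (Fin N) (Fin N) ℂ) (γ : ℝ → ℝ) (x : ℝ) :
    Matrix (Fin N) (Fin N) ℂ :=
  schurMul (specProj (H x)) (fun j k => (rate (H x) (γ x) j k)⁻¹) (groundProjDeriv H x)

/-- The solution `Y` of `L* Y = P_0'` without diagonal blocks, where `L*` is the transpose of the
Lindbladian with respect to the trace pairing. -/
noncomputable def dualCorrector (H : ℝ → Matrix (Fin N) (Fin N) ℂ) (γ : ℝ → ℝ) (x : ℝ) :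
    Matrix (Fin N) (Fin N) ℂ :=
  schurMul (specProj (H x)) (fun j k => (rate (H x) (γ x) k j)⁻¹) (groundProjDeriv H x)

section Pointwise

variable {x : ℝ}

lemma schurMul_specProj_zero (hA : (H x).IsHermitian) (hinj : Function.Injective (energy (H x)))
    {c : Fin N → Fin N → ℂ} (hc : c 0 0 = 0) :
    schurMul (specProj (H x)) c (specProj (H x) 0) = 0 := by
  have hP := specProj_mul_specProj hA hinj
  refine Finset.sum_eq_zero fun j _ => Finset.sum_eq_zero fun k _ => ?_
  rw [hP]
  split_ifs with hj
  · rw [hP]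
    split_ifs with hk
    · subst hj
      subst hk
      rw [hc, zero_smul]
    · simp
  · simp

lemma lindbladian_specProj_zero (hA : (H x).IsHermitian) (hinj : Function.Injective (energy (H x)))
    (g : ℝ) : lindbladian (H x) g (specProj (H x) 0) = 0 := by
  rw [lindbladian_eq_schurMul hA hinj, schurMul_specProj_zero hA hinj (rate_self _ _)]

/-- The transposed Lindbladian also kills `P_0`, so the generator alone never changes the ground
state population. -/
lemma trace_specProj_zero_mul_lindbladian (hA : (H x).IsHermitian) (hinj : Function.Injective (energy (H x)))
    (g : ℝ) (ρ : Matrix (Fin N) (Fin N) ℂ) :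
    (specProj (H x) 0 * lindbladian (H x) g ρ).trace = 0 := by
  rw [lindbladian_eq_schurMul hA hinj,
    ← trace_schurMul_mul (fun j k => rate (H x) g k j),
    schurMul_specProj_zero hA hinj (c := fun j k => rate (H x) g k j) (rate_self _ _), zero_mul,
    Matrix.trace_zero]

lemma trace_dualCorrector_mul_specProj_zero (hA : (H x).IsHermitian)
    (hinj : Function.Injective (energy (H x))) :
    (dualCorrector H γ x * specProj (H x) 0).trace = 0 := by
  rw [dualCorrector, trace_schurMul_mul,
    -- The symbol at `(0, 0)` is the inverse of a zero rate, which is `0` by convention.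
    schurMul_specProj_zero hA hinj (by simp [rate_self]), mul_zero, Matrix.trace_zero]

/-- The kernel of the symbol is the diagonal, where the blocks of `P_0'` vanish. -/
lemma lindbladian_corrector (hA : (H x).IsHermitian) (hinj : Function.Injective (energy (H x)))
    (hX : groundProjDeriv H x =
      specProj (H x) 0 * groundProjDeriv H x + groundProjDeriv H x * specProj (H x) 0) :
    lindbladian (H x) (γ x) (corrector H γ x) = groundProjDeriv H x := by
  have hP := specProj_mul_specProj hA hinj
  rw [lindbladian_eq_schurMul hA hinj, corrector, schurMul_schurMul hP]
  conv_rhs => rw [← schurMul_one (sum_specProj hA hinj) (groundProjDeriv H x)]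
  refine schurMul_congr fun j k => ?_
  by_cases h : j = k
  · exact Or.inr (block_eq_zero hP hX (by rw [h]))
  · exact Or.inl (mul_inv_cancel₀ (rate_ne_zero hinj _ h))

lemma trace_dualCorrector_mul_lindbladian (hA : (H x).IsHermitian) (hinj : Function.Injective (energy (H x)))
    (hX : groundProjDeriv H x =
      specProj (H x) 0 * groundProjDeriv H x + groundProjDeriv H x * specProj (H x) 0)
    (ρ : Matrix (Fin N) (Fin N) ℂ) :
    (dualCorrector H γ x * lindbladian (H x) (γ x) ρ).trace = (groundProjDeriv H x * ρ).trace := by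
  have hP := specProj_mul_specProj hA hinj
  rw [lindbladian_eq_schurMul hA hinj, ← trace_schurMul_mul (fun j k => rate (H x) (γ x) k j),
    dualCorrector, schurMul_schurMul hP]
  congr 2
  conv_rhs => rw [← schurMul_one (sum_specProj hA hinj) (groundProjDeriv H x)]
  refine schurMul_congr fun j k => ?_
  by_cases h : j = k
  · exact Or.inr (block_eq_zero hP hX (by rw [h]))
  · exact Or.inl (mul_inv_cancel₀ (rate_ne_zero hinj _ (Ne.symm h)))

/-- The leading coefficient of the tunneling: conjugate rates for `(a, 0)` and `(0, a)` combine into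
the summands of `M`. -/
lemma re_trace_dualCorrector_mul_groundProjDeriv (hA : (H x).IsHermitian)
    (hinj : Function.Injective (energy (H x)))
    (hX : groundProjDeriv H x =
      specProj (H x) 0 * groundProjDeriv H x + groundProjDeriv H x * specProj (H x) 0) :
    (dualCorrector H γ x * groundProjDeriv H x).trace.re = -(2 * mass H γ x) := by
  rw [dualCorrector, trace_schurMul_mul_self (specProj_mul_specProj hA hinj) hX, Complex.re_sum,
    mass, Finset.mul_sum, ← Finset.sum_neg_distrib]
  refine Finset.sum_congr rfl fun a ha => ?_
  have ha0 : a ≠ 0 := (Finset.mem_filter.mp ha).2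
  rw [inv_rate_add_inv_rate (γ x) ha0, Complex.re_ofReal_mul]
  ring

end Pointwise

/-- Each trace in the sum is the squared Frobenius norm of `P_0' P_a`. -/
lemma mass_nonneg {x : ℝ} (hA : (H x).IsHermitian) (hinj : Function.Injective (energy (H x)))
    (hX : (groundProjDeriv H x).IsHermitian) (hγ : 0 ≤ γ x) : 0 ≤ mass H γ x := by
  refine Finset.sum_nonneg fun a _ => div_nonneg (mul_nonneg hγ ?_) (by positivity)
  have hPP : specProj (H x) a * specProj (H x) a = specProj (H x) a := by
    simp [specProj_mul_specProj hA hinj]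
  have h : (specProj (H x) a * groundProjDeriv H x ^ 2).trace =
      ((groundProjDeriv H x * specProj (H x) a)ᴴ *
        (groundProjDeriv H x * specProj (H x) a)).trace := by
    rw [Matrix.conjTranspose_mul, hX.eq, (isHermitian_specProj hA a).eq]
    conv_lhs => rw [← hPP, mul_assoc, Matrix.trace_mul_comm]
    simp only [sq, mul_assoc]
  rw [h, re_trace_conjTranspose_mul_self]
  positivity

end Path

/-! ### Calculus along a parametrization -/

section Parametrization

variable {E : Type*} [NormedAddCommGroup E] [NormedSpace ℝ E]

lemma exists_bound_of_contDiffOn {F : ℝ → E} (hF : ContDiffOn ℝ 1 F (Icc 0 1)) :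
    ∃ C : ℝ, 0 ≤ C ∧ ∀ x ∈ Icc (0 : ℝ) 1, ‖F x‖ ≤ C ∧ ‖derivWithin F (Icc 0 1) x‖ ≤ C := by
  obtain ⟨C₁, h₁⟩ := isCompact_Icc.exists_bound_of_continuousOn hF.continuousOn
  obtain ⟨C₂, h₂⟩ := isCompact_Icc.exists_bound_of_continuousOn
    (hF.continuousOn_derivWithin (uniqueDiffOn_Icc zero_lt_one) le_rfl)
  have h0 : 0 ≤ C₁ := (norm_nonneg _).trans (h₁ 0 (left_mem_Icc.mpr zero_le_one))
  exact ⟨max C₁ C₂, h0.trans (le_max_left _ _), fun x hx =>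
    ⟨(h₁ x hx).trans (le_max_left _ _), (h₂ x hx).trans (le_max_right _ _)⟩⟩

variable {q : ℝ → ℝ}

lemma hasDerivWithinAt_comp_parametrization {F : ℝ → E}
    (hF : DifferentiableOn ℝ F (Icc 0 1)) (hq : ContDiffOn ℝ 2 q (Icc 0 1))
    (hqI : MapsTo q (Icc 0 1) (Icc 0 1)) {s : ℝ} (hs : s ∈ Icc (0 : ℝ) 1) :
    HasDerivWithinAt (fun t => F (q t))
      (derivWithin q (Icc 0 1) s • derivWithin F (Icc 0 1) (q s)) (Icc 0 1) s :=
  (hF (q s) (hqI hs)).hasDerivWithinAt.scomp s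
    (hq.differentiableOn two_ne_zero s hs).hasDerivWithinAt hqI

lemma hasDerivWithinAt_derivWithin (hq : ContDiffOn ℝ 2 q (Icc 0 1)) {s : ℝ}
    (hs : s ∈ Icc (0 : ℝ) 1) :
    HasDerivWithinAt (derivWithin q (Icc 0 1)) (iteratedDerivWithin 2 q (Icc 0 1) s)
      (Icc 0 1) s := by
  have h : ContDiffOn ℝ 1 (derivWithin q (Icc 0 1)) (Icc 0 1) :=
    hq.derivWithin (uniqueDiffOn_Icc zero_lt_one) (by norm_num)
  have h2 := (h.differentiableOn one_ne_zero s hs).hasDerivWithinAt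
  rwa [iteratedDerivWithin_succ, iteratedDerivWithin_one]

/-- The velocity field `q'(s) F(q(s))` of a parametrized path is differentiable, with a derivative
controlled by the first two derivatives of the parametrization. -/
lemma exists_hasDerivWithinAt_velocity {F : ℝ → E} {C K : ℝ}
    (hF : ContDiffOn ℝ 1 F (Icc 0 1))
    (hC : ∀ x ∈ Icc (0 : ℝ) 1, ‖F x‖ ≤ C ∧ ‖derivWithin F (Icc 0 1) x‖ ≤ C)
    (hq : ContDiffOn ℝ 2 q (Icc 0 1)) (hqI : MapsTo q (Icc 0 1) (Icc 0 1))
    (hK : ∀ s ∈ Icc (0 : ℝ) 1, |derivWithin q (Icc 0 1) s| ≤ K ∧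
      |iteratedDerivWithin 2 q (Icc 0 1) s| ≤ K) :
    ∃ V : ℝ → E, ∀ s ∈ Icc (0 : ℝ) 1,
      HasDerivWithinAt (fun t => derivWithin q (Icc 0 1) t • F (q t)) (V s) (Icc 0 1) s ∧
      ‖derivWithin q (Icc 0 1) s • F (q s)‖ ≤ K * C ∧ ‖V s‖ ≤ K * (K * C) + K * C := by
  refine ⟨_, fun s hs => ⟨(hasDerivWithinAt_derivWithin hq hs).smul
    (hasDerivWithinAt_comp_parametrization (hF.differentiableOn one_ne_zero) hq hqI hs), ?_, ?_⟩⟩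
  all_goals
    have hK0 : 0 ≤ K := (abs_nonneg _).trans (hK s hs).1
    have hC0 : 0 ≤ C := (norm_nonneg _).trans (hC (q s) (hqI hs)).1
  · rw [norm_smul]
    exact mul_le_mul (hK s hs).1 (hC (q s) (hqI hs)).1 (norm_nonneg _) hK0
  · refine (norm_add_le _ _).trans (add_le_add ?_ ?_)
    · rw [norm_smul, norm_smul]
      exact mul_le_mul (hK s hs).1 (mul_le_mul (hK s hs).1 (hC (q s) (hqI hs)).2 (norm_nonneg _)
        hK0) (by positivity) hK0
    · rw [norm_smul]
      exact mul_le_mul (hK s hs).2 (hC (q s) (hqI hs)).1 (norm_nonneg _) hK0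

lemma hasDerivWithinAt_integral_of_continuousOn {g : ℝ → ℝ} (hg : ContinuousOn g (Icc 0 1))
    {s : ℝ} (hs : s ∈ Icc (0 : ℝ) 1) :
    HasDerivWithinAt (fun t => ∫ u in (0 : ℝ)..t, g u) (g s) (Icc 0 1) s := by
  -- A continuous extension to the whole line gives the one-sided derivatives at the end points as
  -- well.
  set G : ℝ → ℝ := IccExtend (zero_le_one (α := ℝ)) ((Icc (0 : ℝ) 1).domRestrict g) with hG
  have hGc : Continuous G := (continuousOn_iff_continuous_domRestrict.mp hg).Icc_extend'
  have hGg : ∀ u ∈ Icc (0 : ℝ) 1, G u = g u := fun u hu => IccExtend_of_mem _ _ hu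
  have h := (hGc.integral_hasStrictDerivAt 0 s).hasDerivAt.hasDerivWithinAt (s := Icc (0 : ℝ) 1)
  rw [hGg s hs] at h
  refine h.congr_of_mem (fun t ht => ?_) hs
  refine intervalIntegral.integral_congr fun u hu => (hGg u ?_).symm
  rw [uIcc_of_le ht.1] at hu
  exact ⟨hu.1, hu.2.trans ht.2⟩

end Parametrization

/-! ### The adiabatic estimate and the tunneling formula -/

section Evolution

variable {N : ℕ} [NeZero N] {H : ℝ → Matrix (Fin N) (Fin N) ℂ} {γ q : ℝ → ℝ} {ε K : ℝ}
  {ρ : ℝ → Matrix (Fin N) (Fin N) ℂ}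

/-- The adiabatic theorem: the evolved state stays `ε`-close to the ground state projection. -/
lemma norm_sub_groundProj_le (hHerm : ∀ x ∈ Icc (0 : ℝ) 1, (H x).IsHermitian)
    (hinj : ∀ x ∈ Icc (0 : ℝ) 1, Function.Injective (energy (H x)))
    (hP : ∀ a, ContDiffOn ℝ 2 (fun x => specProj (H x) a) (Icc 0 1))
    (hγ : ∀ x ∈ Icc (0 : ℝ) 1, 0 ≤ γ x) (hq : ContDiffOn ℝ 2 q (Icc 0 1))
    (hqI : MapsTo q (Icc 0 1) (Icc 0 1)) (hε : 0 < ε) (hρ : IsAdiabaticEvolution H γ q ε ρ)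
    {V : ℝ → Matrix (Fin N) (Fin N) ℂ} {b d : ℝ}
    (hV : ∀ s ∈ Icc (0 : ℝ) 1,
      HasDerivWithinAt (fun t => derivWithin q (Icc 0 1) t • corrector H γ (q t)) (V s)
        (Icc 0 1) s ∧
      ‖derivWithin q (Icc 0 1) s • corrector H γ (q s)‖ ≤ b ∧ ‖V s‖ ≤ d)
    {s : ℝ} (hs : s ∈ Icc (0 : ℝ) 1) :
    ‖ρ s - specProj (H (q s)) 0‖ ≤ ε * (2 * b + N * d) := by
  have hεC : (ε : ℂ) ≠ 0 := by exact_mod_cast hε.ne'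
  have hd0 : 0 ≤ d := (norm_nonneg _).trans (hV s hs).2.2
  choose! v hv hvL using hρ.evolve
  set B : ℝ → Matrix (Fin N) (Fin N) ℂ := fun t =>
    derivWithin q (Icc 0 1) t • corrector H γ (q t) with hB
  -- Subtracting `ε B` absorbs the drift of `P`: `L r = ε(ρ̇ - Ṗ)`, so `ṙ` is a dissipative term
  -- minus `ε Ḃ`.
  set r : ℝ → Matrix (Fin N) (Fin N) ℂ := fun t => ρ t - specProj (H (q t)) 0 - ε • B t with hr
  have hrd : ∀ t ∈ Icc (0 : ℝ) 1, HasDerivWithinAt r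
      (v t - derivWithin q (Icc 0 1) t • groundProjDeriv H (q t) - ε • V t) (Icc 0 1) t :=
    fun t ht => ((hv t ht).sub (hasDerivWithinAt_comp_parametrization
      ((hP 0).differentiableOn two_ne_zero) hq hqI ht)).sub ((hV t ht).1.const_smul ε)
  have hL : ∀ t ∈ Icc (0 : ℝ) 1, lindbladian (H (q t)) (γ (q t)) (r t) =
      (ε : ℂ) • (v t - derivWithin q (Icc 0 1) t • groundProjDeriv H (q t)) := by
    intro t ht
    have hA := hHerm _ (hqI ht)
    have hi := hinj _ (hqI ht)
    have h1 := lindbladian_specProj_zero hA hi (γ (q t))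
    have h2 := lindbladian_corrector (γ := γ) hA hi (groundProjDeriv_eq hHerm hinj hP (hqI ht))
    have hεB : ε • B t = ((ε * derivWithin q (Icc 0 1) t : ℝ) : ℂ) • corrector H γ (q t) := by
      rw [hB, smul_smul, Complex.coe_smul]
    rw [smul_sub, hvL t ht]
    simp only [hr]
    rw [hεB]
    rw [lindbladian_eq_schurMul hA hi] at h1 h2 ⊢
    rw [lindbladian_eq_schurMul hA hi, schurMul_sub, schurMul_sub, schurMul_smul, h1, h2, sub_zero,
      Complex.ofReal_mul, mul_smul, Complex.coe_smul (derivWithin q (Icc 0 1) t)]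
  have hdiss : ∀ t ∈ Icc (0 : ℝ) 1,
      ((r t)ᴴ * (v t - derivWithin q (Icc 0 1) t • groundProjDeriv H (q t) - ε • V t)).trace.re ≤
        (ε * (N * d)) * ‖r t‖ := by
    intro t ht
    have h1 := re_trace_conjTranspose_mul_lindbladian_nonpos (hHerm _ (hqI ht)) (hinj _ (hqI ht))
      (hγ _ (hqI ht)) (r t)
    rw [hL t ht, mul_smul_comm, Matrix.trace_smul, smul_eq_mul, Complex.re_ofReal_mul] at h1
    have h2 := nonpos_of_mul_nonpos_right h1 hε
    rw [mul_sub, Matrix.trace_sub, Complex.sub_re, mul_smul_comm, Matrix.trace_smul,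
      Complex.smul_re, smul_eq_mul]
    have h3 := neg_le_of_abs_le (abs_re_trace_mul_le (r t)ᴴ (V t))
    rw [Matrix.frobenius_norm_conjTranspose] at h3
    have h4 : (N : ℝ) * (‖r t‖ * ‖V t‖) ≤ N * (‖r t‖ * d) := by
      gcongr
      exact (hV t ht).2.2
    have h5 := mul_le_mul_of_nonneg_left (h4.trans' (neg_le.mp h3)) hε.le
    linarith
  -- Initially `ρ = P`, so `r = -ε B`. This and adding `ε B` back at the end give the two copies of
  -- `b`.
  have hr0 : ‖r 0‖ ≤ ε * b := by
    simp only [hr]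
    rw [hρ.init, sub_self, zero_sub, norm_neg, norm_smul, Real.norm_of_nonneg hε.le]
    exact mul_le_mul_of_nonneg_left (hV 0 (left_mem_Icc.mpr zero_le_one)).2.1 hε.le
  have hmain := norm_le_of_re_trace_deriv_le hrd hdiss (by positivity) hs
  have hsplit : ρ s - specProj (H (q s)) 0 = r s + ε • B s := by simp [hr]
  have hBs : ‖ε • B s‖ ≤ ε * b := by
    rw [norm_smul, Real.norm_of_nonneg hε.le]
    exact mul_le_mul_of_nonneg_left (hV s hs).2.1 hε.le
  rw [hsplit]
  have := norm_add_le (r s) (ε • B s)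
  linarith

/-- The tunneling is given to second order by the integral of the mass term. -/
lemma abs_tunneling_sub_le (hHerm : ∀ x ∈ Icc (0 : ℝ) 1, (H x).IsHermitian)
    (hinj : ∀ x ∈ Icc (0 : ℝ) 1, Function.Injective (energy (H x)))
    (hP : ∀ a, ContDiffOn ℝ 2 (fun x => specProj (H x) a) (Icc 0 1))
    (hq : ContDiffOn ℝ 2 q (Icc 0 1))
    (hqI : MapsTo q (Icc 0 1) (Icc 0 1)) (hε : 0 < ε) (hρ : IsAdiabaticEvolution H γ q ε ρ)
    (hcont : ContinuousOn (fun s => mass H γ (q s) * derivWithin q (Icc 0 1) s ^ 2) (Icc 0 1))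
    {W : ℝ → Matrix (Fin N) (Fin N) ℂ} {b d R : ℝ}
    (hW : ∀ s ∈ Icc (0 : ℝ) 1,
      HasDerivWithinAt (fun t => derivWithin q (Icc 0 1) t • dualCorrector H γ (q t)) (W s)
        (Icc 0 1) s ∧
      ‖derivWithin q (Icc 0 1) s • dualCorrector H γ (q s)‖ ≤ b ∧ ‖W s‖ ≤ d)
    (hR : ∀ s ∈ Icc (0 : ℝ) 1, ‖ρ s - specProj (H (q s)) 0‖ ≤ ε * R) :
    |tunneling H q ρ 1 - 2 * ε * ∫ s in (0 : ℝ)..1,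
      mass H γ (q s) * derivWithin q (Icc 0 1) s ^ 2| ≤ (N * (d * R) + N * (b * R)) * ε ^ 2 := by
  have h0I : (0 : ℝ) ∈ Icc (0 : ℝ) 1 := left_mem_Icc.mpr zero_le_one
  have h1I : (1 : ℝ) ∈ Icc (0 : ℝ) 1 := right_mem_Icc.mpr zero_le_one
  have hb0 : 0 ≤ b := (norm_nonneg _).trans (hW 0 h0I).2.1
  have hd0 : 0 ≤ d := (norm_nonneg _).trans (hW 0 h0I).2.2
  choose! v hv hvL using hρ.evolve
  set P : ℝ → Matrix (Fin N) (Fin N) ℂ := fun t => specProj (H (q t)) 0 with hPdef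
  set X : ℝ → Matrix (Fin N) (Fin N) ℂ := fun t => groundProjDeriv H (q t) with hXdef
  set Y : ℝ → Matrix (Fin N) (Fin N) ℂ := fun t =>
    derivWithin q (Icc 0 1) t • dualCorrector H γ (q t) with hY
  set g : ℝ → ℝ := fun t => mass H γ (q t) * derivWithin q (Icc 0 1) t ^ 2 with hg
  have hPd : ∀ t ∈ Icc (0 : ℝ) 1,
      HasDerivWithinAt P (derivWithin q (Icc 0 1) t • X t) (Icc 0 1) t := fun t ht =>
    hasDerivWithinAt_comp_parametrization ((hP 0).differentiableOn two_ne_zero) hq hqI ht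
  have hYP : ∀ t ∈ Icc (0 : ℝ) 1, (Y t * P t).trace.re = 0 := by
    intro t ht
    rw [hY]
    simp only
    rw [smul_mul_assoc, Matrix.trace_smul, trace_dualCorrector_mul_specProj_zero
      (hHerm _ (hqI ht)) (hinj _ (hqI ht)), smul_zero, Complex.zero_re]
  have hPv : ∀ t ∈ Icc (0 : ℝ) 1, (P t * v t).trace.re = 0 := by
    intro t ht
    have h := congrArg Complex.re (trace_specProj_zero_mul_lindbladian
      (hHerm _ (hqI ht)) (hinj _ (hqI ht)) (γ (q t)) (ρ t))
    rw [← hvL t ht, mul_smul_comm, Matrix.trace_smul, smul_eq_mul, Complex.re_ofReal_mul] at h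
    exact (mul_eq_zero.mp h).resolve_left hε.ne'
  have hYv : ∀ t ∈ Icc (0 : ℝ) 1, ε * (Y t * v t).trace.re =
      derivWithin q (Icc 0 1) t * (X t * ρ t).trace.re := by
    intro t ht
    have h := congrArg Complex.re (trace_dualCorrector_mul_lindbladian (γ := γ)
      (hHerm _ (hqI ht)) (hinj _ (hqI ht)) (groundProjDeriv_eq hHerm hinj hP (hqI ht)) (ρ t))
    rw [← hvL t ht, mul_smul_comm, Matrix.trace_smul, smul_eq_mul, Complex.re_ofReal_mul] at h
    rw [← h, hY]
    simp only
    rw [smul_mul_assoc, Matrix.trace_smul, Complex.smul_re, smul_eq_mul]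
    ring
  have hYX : ∀ t ∈ Icc (0 : ℝ) 1,
      (Y t * (derivWithin q (Icc 0 1) t • X t)).trace.re = -(2 * g t) := by
    intro t ht
    have h := re_trace_dualCorrector_mul_groundProjDeriv (γ := γ)
      (hHerm _ (hqI ht)) (hinj _ (hqI ht)) (groundProjDeriv_eq hHerm hinj hP (hqI ht))
    rw [hY]
    simp only
    rw [smul_mul_assoc, mul_smul_comm, Matrix.trace_smul, Matrix.trace_smul, Complex.smul_re,
      Complex.smul_re, smul_eq_mul, smul_eq_mul, h, hg]
    ring
  -- Differentiate the identity `tr(Y P) = 0`; the derivative of `P` produces the mass term.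
  have hWP : ∀ t ∈ Icc (0 : ℝ) 1, (W t * P t).trace.re = 2 * g t := by
    intro t ht
    have h1 := (hasDerivWithinAt_re_trace_mul (hW t ht).1 (hPd t ht)).congr_of_mem
      (f₁ := fun _ => (0 : ℝ)) (fun u hu => (hYP u hu).symm) ht
    have h2 := (uniqueDiffWithinAt_unitInterval ht).eq_deriv _ h1 (hasDerivWithinAt_const t _ 0)
    have h3 := hYX t ht
    linarith
  -- Tunneling plus boundary term minus predicted value. The terms `q̇ tr(P_0' ρ)` cancel in its
  -- derivative, leaving `ε tr(Ẏ(ρ - P))`, which is `O(ε²)`.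
  set Φ : ℝ → ℝ := fun t => 1 - (P t * ρ t).trace.re + ε * (Y t * ρ t).trace.re -
    2 * ε * ∫ u in (0 : ℝ)..t, g u with hΦ
  have hΦd : ∀ t ∈ Icc (0 : ℝ) 1,
      HasDerivWithinAt Φ (ε * (W t * (ρ t - P t)).trace.re) (Icc 0 1) t := by
    intro t ht
    have h := ((((hasDerivWithinAt_re_trace_mul (hPd t ht) (hv t ht)).const_sub 1).add
      ((hasDerivWithinAt_re_trace_mul (hW t ht).1 (hv t ht)).const_mul ε)).sub
      ((hasDerivWithinAt_integral_of_continuousOn hcont ht).const_mul (2 * ε)))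
    refine h.congr_deriv ?_
    rw [mul_sub, Matrix.trace_sub, Complex.sub_re, smul_mul_assoc, Matrix.trace_smul,
      Complex.smul_re, smul_eq_mul, mul_add, hYv t ht, hPv t ht, hWP t ht]
    ring
  have hbound : ∀ t ∈ Icc (0 : ℝ) 1,
      ‖ε * (W t * (ρ t - P t)).trace.re‖ ≤ ε * (N * (d * (ε * R))) := by
    intro t ht
    rw [norm_mul, Real.norm_of_nonneg hε.le, Real.norm_eq_abs]
    refine mul_le_mul_of_nonneg_left ((abs_re_trace_mul_le _ _).trans ?_) hε.le
    exact mul_le_mul_of_nonneg_left (mul_le_mul (hW t ht).2.2 (hR t ht) (norm_nonneg _) hd0)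
      (Nat.cast_nonneg _)
  have hmv := (convex_Icc (0 : ℝ) 1).norm_image_sub_le_of_norm_hasDerivWithin_le hΦd hbound h0I h1I
  have hΦ0 : Φ 0 = 0 := by
    have htr : (P 0 * ρ 0).trace = 1 := by
      rw [hρ.init, hPdef]
      simp only
      rw [specProj_mul_specProj (hHerm _ (hqI h0I)) (hinj _ (hqI h0I)), if_pos rfl,
        trace_specProj (hHerm _ (hqI h0I)) (hinj _ (hqI h0I))]
    have hYρ : (Y 0 * ρ 0).trace.re = 0 := by
      rw [hρ.init]
      exact hYP 0 h0I
    simp only [hΦ]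
    rw [htr, hYρ]
    simp
  -- As `tr(Y P) = 0`, the boundary term sees only `ρ - P` and gains a factor `ε`.
  have hend : |(Y 1 * ρ 1).trace.re| ≤ N * (b * (ε * R)) := by
    have : (Y 1 * ρ 1).trace.re = (Y 1 * (ρ 1 - P 1)).trace.re := by
      rw [mul_sub, Matrix.trace_sub, Complex.sub_re, hYP 1 h1I, sub_zero]
    rw [this]
    exact (abs_re_trace_mul_le _ _).trans (mul_le_mul_of_nonneg_left
      (mul_le_mul (hW 1 h1I).2.1 (hR 1 h1I) (norm_nonneg _) hb0) (Nat.cast_nonneg _))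
  rw [hΦ0, sub_zero, sub_zero, norm_one, mul_one, Real.norm_eq_abs] at hmv
  have heq : tunneling H q ρ 1 - 2 * ε * ∫ u in (0 : ℝ)..1, g u =
      Φ 1 - ε * (Y 1 * ρ 1).trace.re := by
    simp only [hΦ, tunneling, hPdef]
    ring
  rw [heq]
  calc |Φ 1 - ε * (Y 1 * ρ 1).trace.re| ≤ |Φ 1| + |ε * (Y 1 * ρ 1).trace.re| := abs_sub _ _
    _ ≤ ε * (N * (d * (ε * R))) + ε * (N * (b * (ε * R))) := by
      refine add_le_add hmv ?_
      rw [abs_mul, abs_of_pos hε]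
      exact mul_le_mul_of_nonneg_left hend hε.le
    _ = _ := by ring

/-- Continuity is inherited from the dual corrector, whose trace against `P_0'` is `-2M` up to an
imaginary part. -/
lemma continuousOn_mass (hHerm : ∀ x ∈ Icc (0 : ℝ) 1, (H x).IsHermitian)
    (hinj : ∀ x ∈ Icc (0 : ℝ) 1, Function.Injective (energy (H x)))
    (hP : ∀ a, ContDiffOn ℝ 2 (fun x => specProj (H x) a) (Icc 0 1))
    (hY : ContDiffOn ℝ 1 (dualCorrector H γ) (Icc 0 1)) :
    ContinuousOn (mass H γ) (Icc 0 1) := by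
  have h : ContinuousOn
      (fun x => -(dualCorrector H γ x * groundProjDeriv H x).trace.re / 2) (Icc 0 1) :=
    (((reTrace N).continuous.comp_continuousOn
      (hY.continuousOn.mul (contDiffOn_groundProjDeriv hP).continuousOn)).neg).div_const 2
  refine h.congr fun x hx => ?_
  simp only
  rw [re_trace_dualCorrector_mul_groundProjDeriv (hHerm x hx) (hinj x hx)
    (groundProjDeriv_eq hHerm hinj hP hx)]
  ring

end Evolution

end Dephasing

/-! ### Assembly with constants independent of the parametrization -/

theorem theorem2 {N : ℕ} [NeZero N] (H : ℝ → Matrix (Fin N) (Fin N) ℂ) (γ : ℝ → ℝ)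
    (hH : ContDiffOn ℝ 2 H (Icc 0 1))
    (hHerm : ∀ x ∈ Icc (0 : ℝ) 1, (H x).IsHermitian)
    (hγ : ContDiffOn ℝ 1 γ (Icc 0 1))
    (hγ_nonneg : ∀ x ∈ Icc (0 : ℝ) 1, 0 ≤ γ x)
    (hgap : ∀ x ∈ Icc (0 : ℝ) 1, ∀ a b : Fin N, a ≠ b →
      Dephasing.energy (H x) a ≠ Dephasing.energy (H x) b) :
    DifferentiableOn ℝ (fun x => Dephasing.specProj (H x) 0) (Icc 0 1) ∧
    (∀ x ∈ Icc (0 : ℝ) 1, 0 ≤ Dephasing.mass H γ x) ∧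
    (∀ q : ℝ → ℝ, ContDiffOn ℝ 2 q (Icc 0 1) → MapsTo q (Icc 0 1) (Icc 0 1) →
      IntervalIntegrable
        (fun s => Dephasing.mass H γ (q s) * derivWithin q (Icc 0 1) s ^ 2) volume 0 1) ∧
    ∀ K : ℝ, ∃ C : ℝ, ∀ q : ℝ → ℝ, ContDiffOn ℝ 2 q (Icc 0 1) → MapsTo q (Icc 0 1) (Icc 0 1) →
      (∀ s ∈ Icc (0 : ℝ) 1, |derivWithin q (Icc 0 1) s| ≤ K ∧
        |iteratedDerivWithin 2 q (Icc 0 1) s| ≤ K) →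
      ∀ ε : ℝ, 0 < ε → ∀ ρ : ℝ → Matrix (Fin N) (Fin N) ℂ,
        Dephasing.IsAdiabaticEvolution H γ q ε ρ →
        |Dephasing.tunneling H q ρ 1 -
          2 * ε * ∫ s in (0 : ℝ)..1,
            Dephasing.mass H γ (q s) * derivWithin q (Icc 0 1) s ^ 2| ≤ C * ε ^ 2 := by

  have hinj : ∀ x ∈ Icc (0 : ℝ) 1, Function.Injective (Dephasing.energy (H x)) :=
    fun x hx a b hab => by_contra fun h => hgap x hx a b h hab
  have hP := Dephasing.contDiffOn_specProj hH hHerm hinj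
  have hP1 : ∀ a, ContDiffOn ℝ 1 (fun x => Dephasing.specProj (H x) a) (Icc 0 1) :=
    fun a => (hP a).of_le one_le_two
  have hX := Dephasing.contDiffOn_groundProjDeriv hP
  have hrate := Dephasing.contDiffOn_inv_rate hinj
    (fun a => (Dephasing.contDiffOn_energy hH hHerm hinj a).of_le one_le_two) hγ
  have hB : ContDiffOn ℝ 1 (Dephasing.corrector H γ) (Icc 0 1) :=
    Dephasing.contDiffOn_schurMul hP1 hrate hX
  have hY : ContDiffOn ℝ 1 (Dephasing.dualCorrector H γ) (Icc 0 1) :=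
    Dephasing.contDiffOn_schurMul hP1 (fun j k => hrate k j) hX
  have hcont : ∀ q : ℝ → ℝ, ContDiffOn ℝ 2 q (Icc 0 1) → MapsTo q (Icc 0 1) (Icc 0 1) →
      ContinuousOn (fun s => Dephasing.mass H γ (q s) * derivWithin q (Icc 0 1) s ^ 2)
        (Icc 0 1) := fun q hq hqI =>
    ((Dephasing.continuousOn_mass hHerm hinj hP hY).comp hq.continuousOn hqI).mul
      ((hq.continuousOn_derivWithin (uniqueDiffOn_Icc zero_lt_one) one_le_two).pow 2)
  refine ⟨(hP 0).differentiableOn two_ne_zero, fun x hx => ?_, fun q hq hqI => ?_, fun K => ?_⟩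
  · exact Dephasing.mass_nonneg (hHerm x hx) (hinj x hx)
      (Dephasing.isHermitian_groundProjDeriv hHerm hP hx) (hγ_nonneg x hx)
  · exact ContinuousOn.intervalIntegrable (by
      rw [uIcc_of_le zero_le_one]
      exact hcont q hq hqI)
  · obtain ⟨c₁, -, hc₁⟩ := Dephasing.exists_bound_of_contDiffOn hB
    obtain ⟨c₂, -, hc₂⟩ := Dephasing.exists_bound_of_contDiffOn hY
    -- This is `2b + N d` of the adiabatic estimate with `b = K c₁`, `d = K² c₁ + K c₁`; the bounds
    -- `c₁`, `c₂` are chosen before `q`, `ε` and `ρ`.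
    set R : ℝ := 2 * (K * c₁) + N * (K * (K * c₁) + K * c₁)
    refine ⟨N * ((K * (K * c₂) + K * c₂) * R) + N * (K * c₂ * R), fun q hq hqI hK ε hε ρ hρ => ?_⟩
    obtain ⟨V, hV⟩ := Dephasing.exists_hasDerivWithinAt_velocity hB hc₁ hq hqI hK
    obtain ⟨W, hW⟩ := Dephasing.exists_hasDerivWithinAt_velocity hY hc₂ hq hqI hK
    exact Dephasing.abs_tunneling_sub_le hHerm hinj hP hq hqI hε hρ (hcont q hq hqI) hW
      fun s hs => Dephasing.norm_sub_groundProj_le hHerm hinj hP hγ_nonneg hq hqI hε hρ hV hs
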